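/- All graphs are finite, undirected and simple. A \emph{minor model} of a graph $G$ in a graph $H$ is a family $(X_u)_{u\in V(G)}$ of nonempty, pairwise disjoint subsets of $V(H)$, called \emph{branch sets}, such that $H[X_u]$ is connected for every $u\in V(G)$ and, for every edge $uv$ of $G$, there is an edge of $H$ between $X_u$ and $X_v$. The graph $G$ is a \emph{minor} of $H$ if $H$ has a minor model of $G$, and a \emph{balanced minor} of $H$ if $H$ has a minor model of $G$ in which all branch sets have the same size. The $m\times k$ grid is the graph with vertex set $\{1,\dots,m\}\times\{1,\dots,k\}$ in which $(i,j)$ and $(i',j')$ are adjacent if and only if $|i-i'|+|j-j'|=1$. A graph is \emph{outerplanar} if it has an embedding in the plane such that every vertex lies on the boundary of the unbounded face. \textbf{Proposition.} Let $n$ be a nonnegative integer. If a graph $H$ contains the $n^2\times 4n$ grid as a minor, then $H$ contains every $n$-vertex outerplanar graph as a balanced minor. -/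

import Mathlib

namespace BalancedMinor

/-- The `m × k` grid: vertices are the pairs in `[m] × [k]`, and two pairs are adjacent if and only
if their coordinates satisfy `|i - i'| + |j - j'| = 1`. -/
def grid (m k : ℕ) : SimpleGraph (Fin m × Fin k) where
  Adj p q := |((p.1 : ℕ) : ℤ) - ((q.1 : ℕ) : ℤ)| + |((p.2 : ℕ) : ℤ) - ((q.2 : ℕ) : ℤ)| = 1
  symm := ⟨fun p q h => by
    rw [abs_sub_comm ((q.1 : ℕ) : ℤ), abs_sub_comm ((q.2 : ℕ) : ℤ)]
    exact h⟩
  loopless := ⟨fun p h => by simp at h⟩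

/-- `X` is a minor model of `G` in `H`: the branch sets `X u` are nonempty, pairwise disjoint,
induce connected subgraphs of `H`, and for every edge `uv` of `G` there is an edge of `H` between
`X u` and `X v`. -/
structure IsMinorModel {V W : Type*} (G : SimpleGraph V) (H : SimpleGraph W) (X : V → Set W) :
    Prop where
  nonempty : ∀ u, (X u).Nonempty
  disjoint : ∀ u v, u ≠ v → Disjoint (X u) (X v)
  connected : ∀ u, (H.induce (X u)).Connected
  edge : ∀ u v, G.Adj u v → ∃ x ∈ X u, ∃ y ∈ X v, H.Adj x y

/-- `G` is a minor of `H`. -/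
def IsMinor {V W : Type*} (G : SimpleGraph V) (H : SimpleGraph W) : Prop :=
  ∃ X : V → Set W, IsMinorModel G H X

/-- `G` is a balanced minor of the finite graph `H`: some minor model of `G` in `H` has all its
branch sets of the same size. -/
def IsBalancedMinor {V W : Type*} [Finite W] (G : SimpleGraph V) (H : SimpleGraph W) : Prop :=
  ∃ X : V → Set W, IsMinorModel G H X ∧ ∃ c : ℕ, ∀ u, (X u).ncard = c

/-- The Euclidean plane. -/
abbrev Plane : Type := EuclideanSpace ℝ (Fin 2)

/-- `A` is a (simple) arc in the plane with endpoints `x` and `y`: the image of an injective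
continuous path from `x` to `y`. -/
def IsArc (x y : Plane) (A : Set Plane) : Prop :=
  ∃ γ : Path x y, Function.Injective γ ∧ Set.range γ = A

/-- An embedding of the graph `G` in the plane. Vertices are distinct points, every edge `uv` is an
arc joining the points `u` and `v`, an edge contains no vertices except its endpoints, and two
distinct edges meet only in common endpoints. (The value of `arc` at a pair which is not an edge is
irrelevant.) -/
structure PlaneEmbedding {V : Type*} (G : SimpleGraph V) where
  point : V → Plane
  arc : Sym2 V → Set Plane
  point_injective : Function.Injective point
  isArc : ∀ u v, G.Adj u v → IsArc (point u) (point v) (arc s(u, v))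
  mem_of_point_mem_arc : ∀ e ∈ G.edgeSet, ∀ w, point w ∈ arc e → w ∈ e
  arc_inter_arc : ∀ e ∈ G.edgeSet, ∀ f ∈ G.edgeSet, e ≠ f → ∀ p ∈ arc e ∩ arc f,
    ∃ w, w ∈ e ∧ w ∈ f ∧ point w = p

/-- The set of all points of the plane covered by the embedded graph. -/
def PlaneEmbedding.carrier {V : Type*} {G : SimpleGraph V} (D : PlaneEmbedding G) : Set Plane :=
  Set.range D.point ∪ ⋃ e ∈ G.edgeSet, D.arc e

/-- `F` is a face of the embedding: a connected component of the complement of the embedded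
graph. -/
def PlaneEmbedding.IsFace {V : Type*} {G : SimpleGraph V} (D : PlaneEmbedding G)
    (F : Set Plane) : Prop :=
  ∃ p ∈ D.carrierᶜ, F = connectedComponentIn D.carrierᶜ p

/-- A finite graph is outerplanar if it has an embedding in the plane such that every vertex is on
the boundary of the infinite (unbounded) face. -/
def IsOuterplanar {V : Type*} [Finite V] (G : SimpleGraph V) : Prop :=
  ∃ D : PlaneEmbedding G, ∃ F : Set Plane, D.IsFace F ∧ ¬ Bornology.IsBounded F ∧
    ∀ v, D.point v ∈ frontier F

end BalancedMinor

/-!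
An outerplanar graph has a linear order of its vertices in which no two edges cross, and a graph
with such an order can be laid out in the grid with so much room that the branch sets can be made
equal.

**From the plane to a tournament.** Fix a point `o` of the face whose boundary contains all
vertices, and join it to every vertex `v` by a spoke that avoids all other vertices and all edges
not incident with `v`. Spokes may meet each other and the edges at their own end, so they are easy
to find (`PlaneEmbedding.joinedIn_compl_away`) although edges are arbitrary arcs. No form of the
Jordan curve theorem is needed: all that is used is that for disjoint paths `γ` and `δ` the
difference `γ s - δ t` has a continuous logarithm on the square, which yields a linear relation
between the angles through which each path turns, seen from the ends of the other (`logVar_square`).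
Combining, for two vertices `x` and `y`, the angle of the spoke of `x` seen from `y` with that of
the spoke of `y` seen from `x`, and correcting by the directions of `x` and `y` at `o`, gives an odd
multiple `(2 * m + 1) * π`, antisymmetric in `x` and `y`. The parity of `m` is a tournament, and the
relations say that independent edges do not cross with respect to it, in the sense of parity
(`exists_parityTournament_of_spokes`).

**From a tournament to an order.** Such a tournament need not be transitive, but every edge `ab`
splits the other vertices into two sides with no edges between them (`IsParityTournament.side_eq`).
This makes it possible to build a noncrossing order by induction on the number of vertices: split at
an edge `ab` into two parts whose orders have `a` and `b` as extreme elements, and split such a part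
further at a suitable neighbour of `a` (`IsParityTournament.exists_isNoncrossingOn_extreme`).

**The layout.** Divide the `n ^ 2` rows into `n` bands of `n` rows, and every band into a left and a
right half of `2 * n` columns. Let the half whose branch sets in `H` have the smallest total size be
a left half, of band `b`, say. In this half, the first `n` columns carry a model of `G`: every
vertex has its own row, and an edge spanning `d` rows is drawn `d` columns away from column `n - 1`.
Nested links in the left halves of the bands join the `i`-th vertex to the right half of band `i`,
which it receives as a whole. So the branch sets in `H` can be chosen to have any size between those
of the core and of the full set, and the size of the lightest half is a common one
(`GridLayout.exists_balanced`).
-/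

/-! ### Variation of the logarithm along disjoint paths -/

/-- Every continuous nonvanishing function on a contractible space has a continuous logarithm. -/
theorem exists_continuous_log {X : Type*} [TopologicalSpace X] [LocallyPathConnectedSpace X]
    [ContractibleSpace X] {f : X → ℂ} (hf : Continuous f) (h0 : ∀ x, f x ≠ 0) :
    ∃ g : X → ℂ, Continuous g ∧ ∀ x, Complex.exp (g x) = f x := by
  obtain ⟨x₀⟩ : Nonempty X := inferInstance
  obtain ⟨F, ⟨-, hF⟩, -⟩ := Complex.isCoveringMapOn_exp.existsUnique_continuousMap_lifts
    ⟨f, hf⟩ (a₀ := x₀) (Complex.exp_log (h0 x₀)) (fun x => by simpa using h0 x)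
  exact ⟨F, F.continuous, fun x => congrFun hF x⟩

/-- The variation over `[0, 1]` of a continuous logarithm of `f : ℝ → ℂ` (zero if there is none).
Its imaginary part is the angle through which `f` turns around the origin. -/
noncomputable def logVar (f : ℝ → ℂ) : ℂ :=
  open scoped Classical in
  if h : ∃ g : ℝ → ℂ, Continuous g ∧ ∀ s, Complex.exp (g s) = f s then h.choose 1 - h.choose 0
  else 0

theorem logVar_eq {f g : ℝ → ℂ} (hg : Continuous g) (hfg : ∀ s, Complex.exp (g s) = f s) :
    logVar f = g 1 - g 0 := by
  have h : ∃ g : ℝ → ℂ, Continuous g ∧ ∀ s, Complex.exp (g s) = f s := ⟨g, hg, hfg⟩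
  rw [logVar, dif_pos h]
  obtain ⟨hc, he⟩ := h.choose_spec
  set k := h.choose
  -- Translating by a period, the two logarithms agree at `0`, hence everywhere.
  have key : (fun s => k s) = fun s => g s + (k 0 - g 0) := by
    refine Complex.isCoveringMap_exp.eq_of_comp_eq hc (by fun_prop) ?_ 0 (by ring)
    funext s
    refine Subtype.ext ?_
    change Complex.exp (k s) = Complex.exp (g s + (k 0 - g 0))
    rw [Complex.exp_add, Complex.exp_sub, he, hfg, he, hfg]
    have h0 : f 0 ≠ 0 := by rw [← hfg]; exact Complex.exp_ne_zero _
    field_simp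
  have := congrFun key 1
  rw [this]; ring

theorem exp_logVar {f : ℝ → ℂ} (hf : Continuous f) (h0 : ∀ s, f s ≠ 0) :
    Complex.exp (logVar f) = f 1 / f 0 := by
  obtain ⟨g, hg, hfg⟩ := exists_continuous_log hf h0
  rw [logVar_eq hg hfg, Complex.exp_sub, hfg, hfg]

theorem logVar_neg {f : ℝ → ℂ} (hf : Continuous f) (h0 : ∀ s, f s ≠ 0) :
    logVar (fun s => -f s) = logVar f := by
  obtain ⟨g, hg, hfg⟩ := exists_continuous_log hf h0
  have hg' : Continuous fun s => g s + Real.pi * Complex.I := by fun_prop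
  rw [logVar_eq hg hfg, logVar_eq hg' fun s => by simp [Complex.exp_add, hfg]]
  ring

/-- If two paths `γ` and `δ` are disjoint, then `γ s - δ t` has a continuous logarithm on the
square, so its variation along the two ways around the square is the same. -/
theorem logVar_square {γ δ : ℝ → ℂ} (hγ : Continuous γ) (hδ : Continuous δ)
    (h : ∀ s t, γ s ≠ δ t) :
    logVar (fun s => γ s - δ 0) + logVar (fun t => δ t - γ 1) =
      logVar (fun t => δ t - γ 0) + logVar (fun s => γ s - δ 1) := by
  obtain ⟨g, hg, hfg⟩ := exists_continuous_log (X := ℝ × ℝ) (f := fun p => γ p.1 - δ p.2)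
    (by fun_prop) (fun p => sub_ne_zero.2 (h _ _))
  have e1 (t : ℝ) : logVar (fun s => γ s - δ t) = g (1, t) - g (0, t) :=
    logVar_eq (g := fun s => g (s, t)) (by fun_prop) fun s => hfg (s, t)
  have e2 (s : ℝ) : logVar (fun t => δ t - γ s) = g (s, 1) - g (s, 0) := by
    rw [← logVar_eq (g := fun t => g (s, t)) (by fun_prop) fun t => hfg (s, t),
      ← logVar_neg (by fun_prop) fun t => sub_ne_zero.2 (h _ _)]
    simp
  rw [e1, e1, e2, e2]; ring

/-- `t` is a tournament on `V`, written as a function to `ZMod 2`, with respect to which independent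
edges of `G` do not cross: for `t` coming from a linear order, `t a c + t a d + t b c + t b d` is
the parity of the number of crossings of the chords `ab` and `cd`. -/
structure IsParityTournament {V : Type*} (G : SimpleGraph V) (t : V → V → ZMod 2) : Prop where
  add_swap : ∀ x y, x ≠ y → t x y + t y x = 1
  parity : ∀ a b c d, G.Adj a b → G.Adj c d → a ≠ c → a ≠ d → b ≠ c → b ≠ d →
    t a c + t a d + t b c + t b d = 0

/-- Suppose that a graph is drawn together with paths (spokes) from a point `o` to all its vertices
so that every spoke and every edge with no common vertex are disjoint, and likewise every two
independent edges. Then the graph has a parity tournament. The spokes may meet each other. -/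
theorem exists_parityTournament_of_spokes {V : Type*} (G : SimpleGraph V) (pt : V → ℂ) (o : ℂ)
    (hpt : Function.Injective pt) (ho : ∀ v, o ≠ pt v)
    (γ : V → ℝ → ℂ) (hγ : ∀ v, Continuous (γ v)) (hγ0 : ∀ v, γ v 0 = o) (hγ1 : ∀ v, γ v 1 = pt v)
    (hγpt : ∀ v w s, v ≠ w → γ v s ≠ pt w)
    (e : V → V → ℝ → ℂ) (he : ∀ a b, G.Adj a b → Continuous (e a b))
    (he0 : ∀ a b, G.Adj a b → e a b 0 = pt a) (he1 : ∀ a b, G.Adj a b → e a b 1 = pt b)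
    (heγ : ∀ a b c, G.Adj a b → a ≠ c → b ≠ c → ∀ s s', e a b s ≠ γ c s')
    (hee : ∀ a b c d, G.Adj a b → G.Adj c d → a ≠ c → a ≠ d → b ≠ c → b ≠ d →
      ∀ s s', e a b s ≠ e c d s') : ∃ t, IsParityTournament G t := by
  -- `r x y` is the variation of the angle of the spoke of `x`, seen from `y`.
  set r : V → V → ℂ := fun x y => logVar fun s => γ x s - pt y with hr
  -- The logarithms make `τ x y` an odd multiple of `π * I`, and cancel in the relation for two edges.
  set τ : V → V → ℂ := fun x y =>
    r x y - r y x + Complex.log (o - pt y) - Complex.log (o - pt x) with hτ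
  have hexp : ∀ x y, x ≠ y → Complex.exp (τ x y) = -1 := by
    intro x y hxy
    have h1 : ∀ x y, x ≠ y → Complex.exp (r x y) = (pt x - pt y) / (o - pt y) := by
      intro x y hxy
      have h := exp_logVar (f := fun s => γ x s - pt y) (by have := hγ x; fun_prop)
        fun s => sub_ne_zero.2 (hγpt x y s hxy)
      rwa [hγ0, hγ1] at h
    have hx : o - pt x ≠ 0 := sub_ne_zero.2 (ho x)
    have hy : o - pt y ≠ 0 := sub_ne_zero.2 (ho y)
    have hxy' : pt x - pt y ≠ 0 := sub_ne_zero.2 (hpt.ne hxy)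
    have hyx' : pt y - pt x ≠ 0 := sub_ne_zero.2 (hpt.ne hxy.symm)
    simp only [hτ]
    rw [Complex.exp_sub, Complex.exp_add, Complex.exp_sub, h1 x y hxy, h1 y x hxy.symm,
      Complex.exp_log hx, Complex.exp_log hy]
    field_simp
    ring
  have hπ : (Real.pi : ℂ) * Complex.I ≠ 0 :=
    mul_ne_zero (by exact_mod_cast Real.pi_ne_zero) Complex.I_ne_zero
  have hm : ∀ x y, ∃ m : ℤ, x ≠ y → τ x y = (2 * m + 1) * (Real.pi * Complex.I) := by
    intro x y
    by_cases hxy : x = y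
    · exact ⟨0, fun h => absurd hxy h⟩
    have h := hexp x y hxy
    rw [← Complex.exp_pi_mul_I, Complex.exp_eq_exp_iff_exists_int] at h
    obtain ⟨m, hm⟩ := h
    exact ⟨m, fun _ => by rw [hm]; ring⟩
  choose m hm using hm
  refine ⟨fun x y => (m x y : ZMod 2), fun x y hxy => ?_, ?_⟩
  · have h1 : τ x y + τ y x = 0 := by simp only [hτ]; ring
    rw [hm x y hxy, hm y x hxy.symm, ← add_mul] at h1
    have h2 := (mul_eq_zero.1 h1).resolve_right hπ
    have h3 : 2 * (m x y + m y x + 1) = 0 := by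
      have : ((2 * (m x y + m y x + 1) : ℤ) : ℂ) = 0 := by push_cast; rw [← h2]; ring
      exact_mod_cast this
    have h4 : m y x = -m x y - 1 := by omega
    rw [h4]
    push_cast
    generalize (m x y : ZMod 2) = z
    revert z; decide
  · intro a b c d hab hcd hac had hbc hbd
    -- The variation of the angle along `ab`, seen from `x`, minus that seen from `o`.
    have h1 : ∀ a b x, G.Adj a b → a ≠ x → b ≠ x →
        logVar (fun s => e a b s - pt x) = logVar (fun s => e a b s - o) + r x b - r x a := by
      intro a b x hab hax hbx
      have h := logVar_square (he a b hab) (hγ x) (heγ a b x hab hax hbx)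
      simp only [hγ0, hγ1, he0 a b hab, he1 a b hab] at h
      simp only [hr]
      linear_combination -h
    have h2 := logVar_square (he a b hab) (he c d hcd) (hee a b c d hab hcd hac had hbc hbd)
    rw [he0 c d hcd, he1 c d hcd, he0 a b hab, he1 a b hab] at h2
    rw [h1 a b c hab hac hbc, h1 a b d hab had hbd, h1 c d a hcd hac.symm had.symm,
      h1 c d b hcd hbc.symm hbd.symm] at h2
    have h3 : τ a c - τ a d - τ b c + τ b d = 0 := by
      simp only [hτ]
      linear_combination h2
    rw [hm a c hac, hm a d had, hm b c hbc, hm b d hbd] at h3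
    have h4 : (2 * (m a c - m a d - m b c + m b d : ℂ)) * (Real.pi * Complex.I) = 0 := by
      rw [← h3]; ring
    have h5 := (mul_eq_zero.1 h4).resolve_right hπ
    have h6 : m a c - m a d - m b c + m b d = 0 := by
      have : ((2 * (m a c - m a d - m b c + m b d) : ℤ) : ℂ) = 0 := by push_cast; exact h5
      have : (2 * (m a c - m a d - m b c + m b d) : ℤ) = 0 := by exact_mod_cast this
      omega
    have h7 := congrArg (Int.cast : ℤ → ZMod 2) h6
    push_cast at h7
    simp only [CharTwo.sub_eq_add] at h7
    exact h7

/-! ### Spokes in an outerplanar embedding -/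

namespace BalancedMinor

theorem IsArc.isClosed {x y : Plane} {A : Set Plane} (h : IsArc x y A) :
    IsClosed A := by
  obtain ⟨γ, -, rfl⟩ := h
  exact (isCompact_range γ.continuous).isClosed

theorem PlaneEmbedding.isClosed_arc {V : Type*} {G : SimpleGraph V}
    (D : PlaneEmbedding G) {e : Sym2 V} (he : e ∈ G.edgeSet) : IsClosed (D.arc e) := by
  induction e with
  | h u v => exact (D.isArc u v he).isClosed

theorem PlaneEmbedding.isClosed_carrier {V : Type*} [Finite V] {G : SimpleGraph V}
    (D : PlaneEmbedding G) : IsClosed D.carrier :=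
  (Set.finite_range D.point).isClosed.union
    ((Set.toFinite _).isClosed_biUnion fun _ he => D.isClosed_arc he)

/-- The part of an embedded graph formed by all vertices other than `v` and by all edges not
incident with `v`. -/
def PlaneEmbedding.away {V : Type*} {G : SimpleGraph V} (D : PlaneEmbedding G)
    (v : V) : Set Plane :=
  D.point '' {v}ᶜ ∪ ⋃ e ∈ {e ∈ G.edgeSet | v ∉ e}, D.arc e

theorem PlaneEmbedding.isClosed_away {V : Type*} [Finite V] {G : SimpleGraph V}
    (D : PlaneEmbedding G) (v : V) : IsClosed (D.away v) :=
  (Set.toFinite _).isClosed.union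
    ((Set.toFinite _).isClosed_biUnion fun _ he => D.isClosed_arc he.1)

theorem PlaneEmbedding.away_subset_carrier {V : Type*} {G : SimpleGraph V}
    (D : PlaneEmbedding G) (v : V) : D.away v ⊆ D.carrier :=
  Set.union_subset_union (Set.image_subset_range _ _)
    (Set.biUnion_subset_biUnion_left fun _ he => he.1)

theorem PlaneEmbedding.point_notMem_away {V : Type*} {G : SimpleGraph V}
    (D : PlaneEmbedding G) (v : V) : D.point v ∉ D.away v := by
  rintro (⟨w, hw, h⟩ | h)
  · exact hw (D.point_injective h)
  · simp only [Set.mem_iUnion] at h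
    obtain ⟨e, ⟨he, hv⟩, h⟩ := h
    exact hv (D.mem_of_point_mem_arc e he v h)

/-- A vertex in the closure of a face `F` can be joined to every point of `F` by a path that avoids
the other vertices and all edges not incident with it: go to a point of `F` in a small ball around
the vertex, and then straight to the vertex, possibly through edges incident with it. -/
theorem PlaneEmbedding.joinedIn_compl_away {V : Type*} [Finite V]
    {G : SimpleGraph V} (D : PlaneEmbedding G) {F : Set Plane} (hF : D.IsFace F) {v : V}
    (hv : D.point v ∈ closure F) {o : Plane} (ho : o ∈ F) :
    JoinedIn (D.away v)ᶜ o (D.point v) := by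
  obtain ⟨q, hq, rfl⟩ := hF
  have hopen : IsOpen (D.carrierᶜ) := D.isClosed_carrier.isOpen_compl
  have hpath : IsPathConnected (connectedComponentIn D.carrierᶜ q) :=
    hopen.connectedComponentIn.isConnected_iff_isPathConnected.1
      (isConnected_connectedComponentIn_iff.2 hq)
  obtain ⟨r, hr, hball⟩ := Metric.isOpen_iff.1 (D.isClosed_away v).isOpen_compl _
    (D.point_notMem_away v)
  obtain ⟨p, hpF, hp⟩ := Metric.mem_closure_iff.1 hv r hr
  have h1 : JoinedIn (D.away v)ᶜ o p :=
    (hpath.joinedIn o ho p hpF).mono ((connectedComponentIn_subset _ _).trans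
      (Set.compl_subset_compl.2 (D.away_subset_carrier v)))
  have hb : IsPathConnected (Metric.ball (D.point v) r) :=
    (convex_ball _ _).isPathConnected ⟨_, Metric.mem_ball_self hr⟩
  exact h1.trans ((hb.joinedIn p (by rwa [Metric.mem_ball, dist_comm]) _
    (Metric.mem_ball_self hr)).mono hball)

/-- An outerplanar graph has a parity tournament. Only one face with all vertices in its closure is
needed; whether it is bounded does not matter. -/
theorem IsOuterplanar.exists_parityTournament {V : Type*} [Finite V]
    {G : SimpleGraph V} (hG : IsOuterplanar G) : ∃ t, IsParityTournament G t := by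
  obtain ⟨D, F, hF, -, hfr⟩ := hG
  obtain ⟨o, ho, hoF⟩ : ∃ o ∈ D.carrierᶜ, o ∈ F := by
    obtain ⟨q, hq, rfl⟩ := hF
    exact ⟨q, hq, mem_connectedComponentIn hq⟩
  have hspoke (v : V) : ∃ γ : Path o (D.point v), ∀ s, γ s ∉ D.away v :=
    D.joinedIn_compl_away hF (frontier_subset_closure (hfr v)) hoF
  choose γ hγ using hspoke
  have harc (a b : V) : ∃ e : ℝ → Plane, G.Adj a b →
      Continuous e ∧ e 0 = D.point a ∧ e 1 = D.point b ∧ ∀ s, e s ∈ D.arc s(a, b) := by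
    by_cases hab : G.Adj a b
    · obtain ⟨η, -, hη⟩ := D.isArc a b hab
      refine ⟨η.extend, fun _ => ⟨η.continuous_extend, by simp, by simp, fun s => ?_⟩⟩
      rw [← hη, ← η.extend_range]
      exact Set.mem_range_self s
    · exact ⟨fun _ => 0, fun h => absurd h hab⟩
  choose e he using harc
  have hγ' (v : V) (s : ℝ) : (γ v).extend s ∉ D.away v := by
    obtain ⟨s', hs'⟩ : (γ v).extend s ∈ Set.range (γ v) := by
      rw [← (γ v).extend_range]; exact Set.mem_range_self s
    rw [← hs']; exact hγ v s'
  let Φ : Plane ≃ₜ ℂ := Complex.orthonormalBasisOneI.repr.symm.toHomeomorph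
  refine exists_parityTournament_of_spokes G (fun v => Φ (D.point v)) (Φ o)
    (Φ.injective.comp D.point_injective) (fun v h => ho ?_) (fun v s => Φ ((γ v).extend s))
    (fun v => Φ.continuous.comp (γ v).continuous_extend) (by simp) (by simp)
    (fun v w s hvw h => hγ' v s ?_) (fun a b s => Φ (e a b s))
    (fun a b hab => Φ.continuous.comp (he a b hab).1)
    (fun a b hab => congrArg Φ (he a b hab).2.1) (fun a b hab => congrArg Φ (he a b hab).2.2.1)
    (fun a b c hab hac hbc s s' h => hγ' c s' ?_)
    (fun a b c d hab hcd hac had hbc hbd s s' h => ?_)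
  · rw [Φ.injective h]
    exact Or.inl (Set.mem_range_self v)
  · rw [Φ.injective h]
    exact Or.inl ⟨w, hvw.symm, rfl⟩
  · rw [← Φ.injective h]
    refine Or.inr (Set.mem_biUnion (x := s(a, b)) ⟨hab, ?_⟩ ((he a b hab).2.2.2 s))
    simp [hac.symm, hbc.symm]
  · have h1 := (he a b hab).2.2.2 s
    have h2 := (he c d hcd).2.2.2 s'
    rw [← Φ.injective h] at h2
    obtain ⟨w, hw1, hw2, -⟩ := D.arc_inter_arc s(a, b) hab s(c, d) hcd
      (by simp [hac, had]) _ ⟨h1, h2⟩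
    simp only [Sym2.mem_iff] at hw1 hw2
    grind

end BalancedMinor

/-! ### Noncrossing orders -/

/-- The values of `f` order the vertices in `S` so that no two edges of `G` within `S` cross, when
the vertices are put on a line in this order and the edges are drawn on one side of the line. -/
structure IsNoncrossingOn {V : Type*} (G : SimpleGraph V) (S : Finset V) (f : V → ℤ) : Prop where
  injOn : ∀ x ∈ S, ∀ y ∈ S, f x = f y → x = y
  noncrossing : ∀ p ∈ S, ∀ q ∈ S, ∀ r ∈ S, ∀ s ∈ S, f p < f q → f q < f r → f r < f s →
    G.Adj p r → G.Adj q s → False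

namespace IsNoncrossingOn

variable {V : Type*} {G : SimpleGraph V} {S : Finset V} {f : V → ℤ}

theorem neg (h : IsNoncrossingOn G S f) : IsNoncrossingOn G S fun x => -f x where
  injOn x hx y hy hxy := h.injOn x hx y hy (neg_injective hxy)
  noncrossing p hp q hq r hr s hs h1 h2 h3 h4 h5 :=
    h.noncrossing s hs r hr q hq p hp (neg_lt_neg_iff.1 h3) (neg_lt_neg_iff.1 h2)
      (neg_lt_neg_iff.1 h1) h5.symm h4.symm

theorem add_const (h : IsNoncrossingOn G S f) (k : ℤ) : IsNoncrossingOn G S fun x => f x + k where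
  injOn x hx y hy hxy := h.injOn x hx y hy (by simpa using hxy)
  noncrossing p hp q hq r hr s hs h1 h2 h3 :=
    h.noncrossing p hp q hq r hr s hs (by simpa using h1) (by simpa using h2) (by simpa using h3)

/-- Being noncrossing is invariant under rotation, so any vertex can be made the first one. -/
theorem exists_first (h : IsNoncrossingOn G S f) (a : V) :
    ∃ g, IsNoncrossingOn G S g ∧ g a = 0 ∧ ∀ x ∈ S, 0 ≤ g x := by
  classical
  obtain ⟨M, hM⟩ : ∃ M : ℤ, ∀ x ∈ S, |f x - f a| < M :=
    ⟨∑ x ∈ S, |f x - f a| + 1, fun x hx => Int.lt_add_one_iff.2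
      (Finset.single_le_sum (f := fun x => |f x - f a|) (fun _ _ => abs_nonneg _) hx)⟩
  simp only [abs_lt] at hM
  refine ⟨fun x => if f x < f a then f x - f a + M + M else f x - f a,
    ⟨fun x hx y hy hxy => h.injOn x hx y hy ?_, ?_⟩, by simp, fun x hx => ?_⟩
  · have := hM x hx
    have := hM y hy
    grind
  · intro p hp q hq r hr s hs h1 h2 h3 h4 h5
    have := hM p hp
    have := hM q hq
    have := hM r hr
    have := hM s hs
    have k1 := h.noncrossing p hp q hq r hr s hs
    have k2 := h.noncrossing q hq r hr s hs p hp
    have k3 := h.noncrossing r hr s hs p hp q hq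
    have k4 := h.noncrossing s hs p hp q hq r hr
    have h4' := h4.symm
    have h5' := h5.symm
    grind
  · have := hM x hx
    grind

theorem exists_last (h : IsNoncrossingOn G S f) (a : V) :
    ∃ g, IsNoncrossingOn G S g ∧ g a = 0 ∧ ∀ x ∈ S, g x ≤ 0 := by
  obtain ⟨g, hg, ha, hS⟩ := h.neg.exists_first a
  exact ⟨_, hg.neg, by simp [ha], fun x hx => by simpa using hS x hx⟩

/-- Two noncrossing orders, of `A` with `x` last and of `B` with `x` first, can be concatenated if
`A` and `B` meet in `x` only and there are no edges between them, except possibly an edge from the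
first to the last vertex. -/
theorem concat [DecidableEq V] {A B : Finset V} {f g : V → ℤ} {a b x : V}
    (hf : IsNoncrossingOn G A f) (hg : IsNoncrossingOn G B g)
    (hfx : f x = 0) (hgx : g x = 0) (hA : ∀ y ∈ A, f y ≤ 0) (hB : ∀ y ∈ B, 0 ≤ g y)
    (hAa : ∀ y ∈ A, f a ≤ f y) (hBb : ∀ y ∈ B, g y ≤ g b) (haA : a ∈ A) (hbB : b ∈ B)
    (hxA : x ∈ A) (hxB : x ∈ B) (hAB : ∀ y ∈ A, y ∈ B → y = x)
    (hadj : ∀ y ∈ A, ∀ z ∈ B, G.Adj y z → y = x ∨ z = x ∨ y = a ∧ z = b) :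
    ∃ h, IsNoncrossingOn G (A ∪ B) h ∧ (∀ y ∈ A ∪ B, h a ≤ h y) ∧ ∀ y ∈ A ∪ B, h y ≤ h b := by
  have hA0 : ∀ y ∈ A, y = x ∨ f y < 0 := fun y hy =>
    (hA y hy).eq_or_lt.imp_left fun h => hf.injOn y hy x hxA (h.trans hfx.symm)
  have hB0 : ∀ y ∈ B, y = x ∨ 0 < g y := fun y hy =>
    (hB y hy).eq_or_lt.imp_left fun h => hg.injOn y hy x hxB (h.symm.trans hgx.symm)
  have key : ∀ y ∈ A ∪ B, (y ∈ A ∧ f y ≤ 0 ∧ f a ≤ f y ∧ (y = x ∨ f y < 0)) ∨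
      (y ∈ B ∧ y ∉ A ∧ 0 < g y ∧ g y ≤ g b) := by
    intro y hy
    grind
  refine ⟨fun y => if y ∈ A then f y else g y, ⟨?_, ?_⟩, ?_, ?_⟩
  · intro y hy z hz hyz
    have := key y hy
    have := key z hz
    have := hf.injOn y
    have := hg.injOn y
    grind
  · intro p hp q hq r hr s hs h1 h2 h3 h4 h5
    have kp := key p hp
    have kq := key q hq
    have kr := key r hr
    have ks := key s hs
    by_cases hpB : p = x ∨ p ∉ A
    · have := hg.noncrossing p (by grind) q (by grind) r (by grind) s (by grind)
      grind
    by_cases hsA : s ∈ A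
    · have := hf.noncrossing p (by grind) q (by grind) r (by grind) s (by grind)
      grind
    have := hadj p (by grind)
    have := hadj q
    grind
  · intro y hy
    have := key y hy
    grind
  · intro y hy
    have := key y hy
    have := key b (by grind)
    grind

/-- Two noncrossing orders of `A` and `B` with common first element `a` can be merged by inserting
`A` between `a` and the rest of `B`, if `A` and `B` meet in `a` only and there are no edges between
them. -/
theorem insert_after_first [DecidableEq V] {A B : Finset V} {f g : V → ℤ} {a : V}
    (hf : IsNoncrossingOn G A f) (hg : IsNoncrossingOn G B g)
    (hfa : f a = 0) (hga : g a = 0) (hA : ∀ y ∈ A, 0 ≤ f y) (hB : ∀ y ∈ B, 0 ≤ g y)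
    (haA : a ∈ A) (haB : a ∈ B) (hAB : ∀ y ∈ A, y ∈ B → y = a)
    (hadj : ∀ y ∈ A, ∀ z ∈ B, G.Adj y z → y = a ∨ z = a) :
    ∃ h, IsNoncrossingOn G (A ∪ B) h ∧ (∀ y ∈ A ∪ B, h a ≤ h y) ∧
      ∀ b ∈ B, b ≠ a → (∀ y ∈ B, g y ≤ g b) → ∀ y ∈ A ∪ B, h y ≤ h b := by
  obtain ⟨M, hM⟩ : ∃ M : ℤ, ∀ x ∈ A, f x < M :=
    ⟨∑ x ∈ A, f x + 1, fun x hx => Int.lt_add_one_iff.2 (Finset.single_le_sum hA hx)⟩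
  have hA0 : ∀ y ∈ A, y = a ∨ 0 < f y := fun y hy =>
    (hA y hy).eq_or_lt.imp_left fun h => hf.injOn y hy a haA (h.symm.trans hfa.symm)
  have hB0 : ∀ y ∈ B, y = a ∨ 0 < g y := fun y hy =>
    (hB y hy).eq_or_lt.imp_left fun h => hg.injOn y hy a haB (h.symm.trans hga.symm)
  have key : ∀ y ∈ A ∪ B, (y ∈ A ∧ 0 ≤ f y ∧ f y < M ∧ (y = a ∨ 0 < f y)) ∨
      (y ∈ B ∧ y ∉ A ∧ 0 < g y) := by
    intro y hy
    grind
  refine ⟨fun y => if y ∈ A then f y else g y + M, ⟨?_, ?_⟩, ?_, ?_⟩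
  · intro y hy z hz hyz
    have := key y hy
    have := key z hz
    have := hf.injOn y
    have := hg.injOn y
    grind
  · intro p hp q hq r hr s hs h1 h2 h3 h4 h5
    have kp := key p hp
    have kq := key q hq
    have kr := key r hr
    have ks := key s hs
    by_cases hsA : s ∈ A
    · have := hf.noncrossing p (by grind) q (by grind) r (by grind) s (by grind)
      grind
    by_cases hqA : q ∈ A
    · have := hadj q hqA s (by grind) h5
      grind
    · have := hg.noncrossing p (by have := hadj p; grind) q (by grind) r (by grind) s (by grind)
      grind
  · intro y hy
    have := key y hy
    grind
  · intro b hb hba hmax y hy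
    have := key y hy
    grind

/-- Noncrossing orders of `A` and `B` can be merged along a common edge `ab` if `a` and `b` are the
extreme elements of both. -/
theorem glue_edge [DecidableEq V] {A B : Finset V} {f g : V → ℤ} {a b : V}
    (hf : IsNoncrossingOn G A f) (hg : IsNoncrossingOn G B g)
    (hfb : f b = 0) (hgb : g b = 0) (hA : ∀ y ∈ A, f y ≤ 0) (hB : ∀ y ∈ B, 0 ≤ g y)
    (hAa : ∀ y ∈ A, f a ≤ f y) (hBa : ∀ y ∈ B, g y ≤ g a) (haA : a ∈ A) (hbA : b ∈ A)
    (haB : a ∈ B) (hbB : b ∈ B)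
    (hadj : ∀ y ∈ A, ∀ z ∈ B, G.Adj y z → y = a ∨ y = b ∨ z = a ∨ z = b) :
    ∃ h, IsNoncrossingOn G (A ∪ B) h := by
  have hA0 : ∀ y ∈ A, y = b ∨ f y < 0 := fun y hy =>
    (hA y hy).eq_or_lt.imp_left fun h => hf.injOn y hy b hbA (h.trans hfb.symm)
  have hB0 : ∀ y ∈ B, y = b ∨ 0 < g y := fun y hy =>
    (hB y hy).eq_or_lt.imp_left fun h => hg.injOn y hy b hbB (h.symm.trans hgb.symm)
  have hA1 : ∀ y ∈ A, y = a ∨ f a < f y := fun y hy =>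
    (hAa y hy).eq_or_lt.imp_left fun h => hf.injOn y hy a haA h.symm
  have hB1 : ∀ y ∈ B, y = a ∨ g y < g a := fun y hy =>
    (hBa y hy).eq_or_lt.imp_left fun h => hg.injOn y hy a haB h
  have key : ∀ y ∈ A ∪ B, (y ∈ A ∧ f y ≤ 0 ∧ (y = b ∨ f y < 0) ∧ (y = a ∨ f a < f y)) ∨
      (y ∈ B ∧ y ∉ A ∧ 0 < g y ∧ g y < g a) := by
    intro y hy
    grind
  refine ⟨fun y => if y ∈ A then f y else g y, ⟨?_, ?_⟩⟩
  · intro y hy z hz hyz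
    have := key y hy
    have := key z hz
    have := hf.injOn y
    have := hg.injOn y
    grind
  · intro p hp q hq r hr s hs h1 h2 h3 h4 h5
    have kp := key p hp
    have kq := key q hq
    have kr := key r hr
    have ks := key s hs
    by_cases hsA : s ∈ A
    · have := hf.noncrossing p (by grind) q (by grind) r (by grind) s (by grind)
      grind
    by_cases hpB : p = b ∨ p ∉ A
    · have := hg.noncrossing p (by grind) q (by grind) r (by grind) s (by grind)
      grind
    by_cases hpa : p = a
    · -- Seen from `B`, the vertex `a` comes last instead of first.
      have := hg.noncrossing q (by have := hadj q; grind) r (by have := hadj q; grind) s (by grind)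
        p (by grind)
      have := hadj q
      have := h4.symm
      grind
    · have := hadj p
      have := hadj q
      grind

/-- A vertex `a` whose only possible neighbour is the last one can be put first. -/
theorem exists_insert_first [DecidableEq V] {a b : V} (hf : IsNoncrossingOn G S f) (ha : a ∉ S)
    (hb : b ∈ S) (hmax : ∀ y ∈ S, f y ≤ f b) (hadj : ∀ y ∈ S, G.Adj a y → y = b) :
    ∃ h, IsNoncrossingOn G (insert a S) h ∧ (∀ y ∈ insert a S, h a ≤ h y) ∧
      ∀ y ∈ insert a S, h y ≤ h b := by
  obtain ⟨M, hM⟩ : ∃ M : ℤ, ∀ x ∈ S, M < f x :=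
    ⟨-∑ x ∈ S, |f x| - 1, fun x hx => by
      have := Finset.single_le_sum (f := fun x => |f x|) (fun _ _ => abs_nonneg _) hx
      have := neg_abs_le (f x)
      omega⟩
  have := hM b hb
  refine ⟨fun y => if y = a then M else f y, ⟨?_, ?_⟩, ?_, ?_⟩
  · intro y hy z hz hyz
    have := hM y
    have := hM z
    have := hf.injOn y
    grind
  · intro p hp q hq r hr s hs h1 h2 h3 h4 h5
    have := hM q
    have := hM r
    have := hM s
    by_cases hpa : p = a
    · have := hadj r (by grind) (hpa ▸ h4)
      grind
    · have := hf.noncrossing p (by grind) q (by grind) r (by grind) s (by grind)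
      grind
  · grind
  · grind

/-- An order with values in `ℤ` can be replaced by the ranks of the vertices. -/
theorem exists_rank {V : Type*} [Fintype V] {G : SimpleGraph V} {f : V → ℤ}
    (hf : IsNoncrossingOn G Finset.univ f) :
    ∃ idx : V → ℕ, Function.Injective idx ∧ (∀ v, idx v < Fintype.card V) ∧
      ∀ p q r s, idx p < idx q → idx q < idx r → idx r < idx s → G.Adj p r → G.Adj q s →
        False := by
  have hmono : ∀ u v, f u ≤ f v →
      (Finset.univ.filter fun w => f w < f u).card ≤ (Finset.univ.filter fun w => f w < f v).card :=
    fun u v huv => Finset.card_le_card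
      (Finset.monotone_filter_right _ fun w _ hw => lt_of_lt_of_le hw huv)
  have hlt : ∀ u v, f u < f v →
      (Finset.univ.filter fun w => f w < f u).card < (Finset.univ.filter fun w => f w < f v).card :=
    fun u v huv => Finset.card_lt_card (Finset.ssubset_iff_subset_ne.2
      ⟨Finset.monotone_filter_right _ fun w _ hw => lt_trans hw huv, fun h => by
        have : u ∈ Finset.univ.filter fun w => f w < f v := by simpa using huv
        simp [← h] at this⟩)
  have hlt' : ∀ u v, (Finset.univ.filter fun w => f w < f u).card <
      (Finset.univ.filter fun w => f w < f v).card → f u < f v := fun u v h => by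
    by_contra hle
    exact absurd (hmono v u (not_lt.1 hle)) (not_le.2 h)
  refine ⟨fun v => (Finset.univ.filter fun w => f w < f v).card, fun u v huv => ?_, fun v => ?_,
    fun p q r s h1 h2 h3 => hf.noncrossing p (by simp) q (by simp) r (by simp) s (by simp)
      (hlt' _ _ h1) (hlt' _ _ h2) (hlt' _ _ h3)⟩
  · rcases lt_trichotomy (f u) (f v) with h | h | h
    · exact absurd huv (hlt u v h).ne
    · exact hf.injOn u (by simp) v (by simp) h
    · exact absurd huv (hlt v u h).ne'
  · exact Finset.card_lt_univ_of_notMem (x := v) (by simp)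

end IsNoncrossingOn

/-! ### From parity tournaments to noncrossing orders -/

namespace IsParityTournament

variable {V : Type*} {G : SimpleGraph V} {t : V → V → ZMod 2}

/-- The value of `t a c + t b c` is called the side of `ab` on which `c` is. For `t` coming from a
linear order, it tells whether `c` is between `a` and `b`. If `ab` is an edge, then every edge
disjoint from `ab` has both ends on the same side. -/
theorem side_eq (ht : IsParityTournament G t) {a b c d : V} (hab : G.Adj a b) (hcd : G.Adj c d)
    (hac : c ≠ a) (had : d ≠ a) (hbc : c ≠ b) (hbd : d ≠ b) :
    t a c + t b c = t a d + t b d := by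
  have := ht.parity a b c d hab hcd hac.symm had.symm hbc.symm hbd.symm
  grind

/-- If `x` and `y` are on the same side of `ab`, then `y` being on the same side of `ax` as `b`
excludes `x` being on the same side of `ay` as `b`. In a linear order from `a` to `b` this says that
`x` and `y` do not both precede each other. -/
theorem side_ne (ht : IsParityTournament G t) {a b x y : V} (hxb : x ≠ b) (hyb : y ≠ b)
    (hxy : x ≠ y) (hab : t a x + t b x = t a y + t b y)
    (hx : t a y + t x y = t a b + t x b) : t a x + t y x ≠ t a b + t y b := by
  have h1 := ht.add_swap x y hxy
  have h2 := ht.add_swap x b hxb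
  have h3 := ht.add_swap y b hyb
  intro h
  grind

/-- Suppose that all vertices of `S` other than `a` and `b` are on the same side of `ab`, that `S`
without `a` induces a connected graph, and that `a` has a neighbour other than `b`. Then there is
such a neighbour `x` for which the set `O` of the vertices on the same side of `ax` as `b` contains
no neighbour of `a`, except possibly `b`: take `x` with `O` as small as possible. -/
theorem exists_last_neighbor (ht : IsParityTournament G t) {S : Finset V} {a b : V}
    (hb : b ∈ S) (hab : a ≠ b)
    (hside : ∀ c ∈ S, ∀ d ∈ S, c ≠ a → c ≠ b → d ≠ a → d ≠ b → t a c + t b c = t a d + t b d)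
    (hE : ∀ E : Finset V, (∀ y ∈ E, y ∈ S ∧ y ≠ a) → E.Nonempty →
      (∀ y ∈ E, ∀ z ∈ S, z ≠ a → G.Adj y z → z ∈ E) → b ∈ E)
    (hN : ∃ x ∈ S, G.Adj a x ∧ x ≠ b) :
    ∃ x ∈ S, G.Adj a x ∧ x ≠ b ∧ ∃ O ⊆ S, a ∉ O ∧ x ∉ O ∧ b ∈ O ∧
      (∀ y ∈ O, G.Adj a y → y = b) ∧
      ∀ y ∈ S, y ≠ a → y ≠ x → (y ∈ O ↔ t a y + t x y = t a b + t x b) := by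
  classical
  let O : V → Finset V := fun x => S.filter fun c => c ≠ a ∧ c ≠ x ∧ t a c + t x c = t a b + t x b
  obtain ⟨x, ⟨hxS, hax, hxb⟩, hmin⟩ : ∃ x, (x ∈ S ∧ G.Adj a x ∧ x ≠ b) ∧
      ∀ y, y ∈ S ∧ G.Adj a y ∧ y ≠ b → (O x).card ≤ (O y).card := by
    obtain ⟨x, hx⟩ := hN
    obtain ⟨x, hx, hmin⟩ := (S.filter fun x => G.Adj a x ∧ x ≠ b).exists_min_image
      (fun x => (O x).card) ⟨x, by simpa using hx⟩
    exact ⟨x, by simpa using hx, fun y hy => hmin y (by simpa using hy)⟩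
  have hxa : x ≠ a := hax.ne'
  have hbO : b ∈ O x := by simp [O, hb, hab.symm, hxb.symm]
  have hNO : ∀ y ∈ O x, G.Adj a y → y = b := by
    intro y hy hay
    by_contra hyb
    simp only [O, Finset.mem_filter] at hy
    obtain ⟨hyS, hya, hyx, hyside⟩ := hy
    have hxy : t a x + t y x ≠ t a b + t y b :=
      ht.side_ne hxb hyb hyx.symm (hside x hxS y hyS hxa hxb hya hyb) hyside
    refine absurd (hmin y ⟨hyS, hay, hyb⟩) (not_le.2 (Finset.card_lt_card ⟨?_, ?_⟩))
    · -- A vertex of `O y` outside `O x` would be separated from `b` in `S` without `a`.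
      intro z hz
      by_contra hzx
      refine absurd (hE (O y \ O x) ?_ ⟨z, Finset.mem_sdiff.2 ⟨hz, hzx⟩⟩ ?_) (by grind)
      · intro w hw
        simp only [O, Finset.mem_sdiff, Finset.mem_filter] at hw
        exact ⟨hw.1.1, hw.1.2.1⟩
      · intro u hu w hwS hwa huw
        simp only [O, Finset.mem_sdiff, Finset.mem_filter] at hu ⊢
        have hux : u ≠ x := by rintro rfl; grind
        have huy : u ≠ y := by grind
        have hua : u ≠ a := by grind
        have h1 : w ≠ y → t a u + t y u = t a w + t y w := fun h =>
          ht.side_eq hay huw hua hwa huy h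
        have hwx : w ≠ x := by rintro rfl; grind
        have h2 : t a u + t x u = t a w + t x w := ht.side_eq hax huw hua hwa hux hwx
        have hwy : w ≠ y := by rintro rfl; grind
        grind
    · intro h
      have := h (by simpa [O] using ⟨hyS, hya, hyx, hyside⟩ : y ∈ O x)
      simp [O] at this
  refine ⟨x, hxS, hax, hxb, O x, Finset.filter_subset _ _, by simp [O], by simp [O], hbO, hNO, ?_⟩
  intro y hy h1 h2
  simp [O, hy, h1, h2]

/-- The induction step for noncrossing orders with prescribed ends: if all vertices of `S` other
than `a` and `b` are on the same side of `ab`, then there is one that starts with `a` and ends with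
`b`. If `S` without `a` is disconnected, its part not containing `b` is inserted after `a`.
Otherwise, unless `a` has no neighbour but `b`, the set splits at a neighbour `x` of `a` into a part
from `a` to `x` and a part from `x` to `b`. -/
theorem exists_isNoncrossingOn_extreme (ht : IsParityTournament G t) (S : Finset V)
    (ih : ∀ T : Finset V, T.card < S.card → ∃ f, IsNoncrossingOn G T f)
    (ih' : ∀ T : Finset V, T.card < S.card → ∀ a ∈ T, ∀ b ∈ T, a ≠ b →
      (∀ c ∈ T, ∀ d ∈ T, c ≠ a → c ≠ b → d ≠ a → d ≠ b → t a c + t b c = t a d + t b d) →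
      ∃ f, IsNoncrossingOn G T f ∧ (∀ y ∈ T, f a ≤ f y) ∧ ∀ y ∈ T, f y ≤ f b)
    {a b : V} (ha : a ∈ S) (hb : b ∈ S) (hab : a ≠ b)
    (hside : ∀ c ∈ S, ∀ d ∈ S, c ≠ a → c ≠ b → d ≠ a → d ≠ b → t a c + t b c = t a d + t b d) :
    ∃ f, IsNoncrossingOn G S f ∧ (∀ y ∈ S, f a ≤ f y) ∧ ∀ y ∈ S, f y ≤ f b := by
  classical
  by_cases hE : ∃ E ⊆ S.erase a, E.Nonempty ∧ b ∉ E ∧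
      ∀ y ∈ E, ∀ z ∈ S.erase a, G.Adj y z → z ∈ E
  · -- The graph on `S` without `a` is disconnected.
    obtain ⟨E, hES, hEne, hbE, hcl⟩ := hE
    have hbA : b ∉ insert a E := by grind
    have hAS : insert a E ⊆ S := by grind
    obtain ⟨f₀, hf₀⟩ := ih (insert a E) (Finset.card_lt_card ⟨hAS, fun h => hbA (h hb)⟩)
    obtain ⟨f, hf, hfa, hfpos⟩ := hf₀.exists_first a
    obtain ⟨g₀, hg₀, hga, hgb⟩ := ih' (S \ E)
      (Finset.card_lt_card ⟨Finset.sdiff_subset, fun h => by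
        obtain ⟨e, he⟩ := hEne
        exact (Finset.mem_sdiff.1 (h (Finset.mem_of_mem_erase (hES he)))).2 he⟩) a (by grind) b
      (by grind) hab (fun c hc d hd => hside c (by grind) d (by grind))
    have hU : insert a E ∪ S \ E = S := by grind
    obtain ⟨h, hh, hmin, hmax⟩ := hf.insert_after_first (hg₀.add_const (-g₀ a)) hfa (by simp)
      hfpos (fun y hy => by have := hga y hy; omega) (by simp) (by grind) (by grind)
      (fun y hy z hz hyz => by
        have := hcl y
        grind)
    rw [hU] at hh hmin hmax
    exact ⟨h, hh, hmin, hmax b (by grind) hab.symm fun y hy => by have := hgb y hy; omega⟩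
  by_cases hN : ∀ x ∈ S, G.Adj a x → x = b
  · obtain ⟨f₀, hf₀⟩ := ih (S.erase a) (Finset.card_erase_lt_of_mem ha)
    obtain ⟨f, hf, hfb, hfneg⟩ := hf₀.exists_last b
    have := hf.exists_insert_first (a := a) (b := b) (by simp) (by grind)
      (fun y hy => by rw [hfb]; exact hfneg y hy) (fun y hy => hN y (by grind))
    rwa [Finset.insert_erase ha] at this
  -- Split at the neighbour `x` of `a` that comes last before `b`.
  obtain ⟨x, hxS, hax, hxb, O, hOS, haO, hxO, hbO, hNO, hOmem⟩ :=
    ht.exists_last_neighbor hb hab hside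
      (fun E hES hEne hcl => by
        by_contra hbE
        exact hE ⟨E, fun y hy => by have := hES y hy; grind, hEne, hbE, fun y hy z hz =>
          hcl y hy z (Finset.mem_of_mem_erase hz) (Finset.ne_of_mem_erase hz)⟩)
      (by push Not at hN; exact hN)
  have hxa : x ≠ a := hax.ne'
  obtain ⟨f, hf, hfa, hfx⟩ := ih' (S \ O)
    (Finset.card_lt_card ⟨Finset.sdiff_subset, fun h => (Finset.mem_sdiff.1 (h hb)).2 hbO⟩)
    a (by grind) x (by grind) hxa.symm (by
      intro c hc d hd hca hcx hda hdx
      have h1 := hOmem c (by grind) hca hcx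
      have h2 := hOmem d (by grind) hda hdx
      have h3 : t a c + t x c ≠ t a b + t x b := by grind
      have h4 : t a d + t x d ≠ t a b + t x b := by grind
      revert h3 h4
      generalize t a c + t x c = p
      generalize t a d + t x d = q
      generalize t a b + t x b = r
      revert p q r
      decide)
  obtain ⟨g, hg, hgx, hgb⟩ := ih' (insert x O)
    (Finset.card_lt_card ⟨by grind, fun h => by have := h ha; grind⟩)
    x (by grind) b (by grind) hxb (by
      intro c hc d hd hcx hcb hdx hdb
      have h1 := hOmem c (by grind) (by grind) hcx
      have h2 := hOmem d (by grind) (by grind) hdx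
      have h3 := hside c (by grind) d (by grind) (by grind) hcb (by grind) hdb
      grind)
  have hU : S \ O ∪ insert x O = S := by
    rw [Finset.union_insert, Finset.sdiff_union_of_subset hOS, Finset.insert_eq_of_mem hxS]
  have := (hf.add_const (-f x)).concat (hg.add_const (-g x)) (a := a) (b := b) (x := x)
    (by simp) (by simp)
    (fun y hy => by have := hfx y hy; omega) (fun y hy => by have := hgx y hy; omega)
    (fun y hy => by have := hfa y hy; omega) (fun y hy => by have := hgb y hy; omega)
    (by simp [ha, haO]) (by simp [hbO]) (by simp [hxS, hxO]) (by simp)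
    (fun y hy hy' => (Finset.mem_insert.1 hy').resolve_right (Finset.mem_sdiff.1 hy).2)
    (fun y hy z hz hyz => by
      by_contra! hcon
      obtain ⟨h1, h2, h3⟩ := hcon
      have hzO : z ∈ O := (Finset.mem_insert.1 hz).resolve_left h2
      obtain ⟨hyS, hyO⟩ := Finset.mem_sdiff.1 hy
      by_cases hya : y = a
      · subst hya
        exact h3 rfl (hNO z hzO hyz)
      · have hza : z ≠ a := fun h => haO (h ▸ hzO)
        rw [hOmem y hyS hya h1, ht.side_eq hax hyz hya hza h1 h2] at hyO
        exact hyO ((hOmem z (hOS hzO) hza h2).1 hzO))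
  rwa [hU] at this

/-- Every finite set of vertices of a graph with a parity tournament has a noncrossing order. -/
theorem exists_isNoncrossingOn (ht : IsParityTournament G t) (S : Finset V) :
    ∃ f, IsNoncrossingOn G S f := by
  classical
  suffices h : ∀ k, ∀ S : Finset V, S.card = k → (∃ f, IsNoncrossingOn G S f) ∧
      ∀ a ∈ S, ∀ b ∈ S, a ≠ b →
        (∀ c ∈ S, ∀ d ∈ S, c ≠ a → c ≠ b → d ≠ a → d ≠ b → t a c + t b c = t a d + t b d) →
        ∃ f, IsNoncrossingOn G S f ∧ (∀ y ∈ S, f a ≤ f y) ∧ ∀ y ∈ S, f y ≤ f b from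
    (h _ S rfl).1
  intro k
  induction k using Nat.strong_induction_on with
  | _ k ih =>
  have hext : ∀ S : Finset V, S.card ≤ k → ∀ a ∈ S, ∀ b ∈ S, a ≠ b →
      (∀ c ∈ S, ∀ d ∈ S, c ≠ a → c ≠ b → d ≠ a → d ≠ b → t a c + t b c = t a d + t b d) →
      ∃ f, IsNoncrossingOn G S f ∧ (∀ y ∈ S, f a ≤ f y) ∧ ∀ y ∈ S, f y ≤ f b := by
    intro S hS a ha b hb hab hside
    exact ht.exists_isNoncrossingOn_extreme S (fun T hT => (ih _ (hT.trans_le hS) T rfl).1)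
      (fun T hT => (ih _ (hT.trans_le hS) T rfl).2) ha hb hab hside
  intro S hS
  refine ⟨?_, hext S hS.le⟩
  by_cases hedge : ∃ a ∈ S, ∃ b ∈ S, G.Adj a b
  · obtain ⟨a, ha, b, hb, hab⟩ := hedge
    -- Order the vertices on the two sides of the edge `ab` separately.
    have hpart : ∀ i : ZMod 2, ∃ f, IsNoncrossingOn G
        (S.filter fun c => c = a ∨ c = b ∨ t a c + t b c = i) f ∧
        (∀ y ∈ S.filter fun c => c = a ∨ c = b ∨ t a c + t b c = i, f a ≤ f y) ∧
        ∀ y ∈ S.filter fun c => c = a ∨ c = b ∨ t a c + t b c = i, f y ≤ f b := by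
      intro i
      refine hext _ ((Finset.card_filter_le _ _).trans hS.le) a (by simp [ha]) b (by simp [hb])
        hab.ne ?_
      intro c hc d hd
      simp only [Finset.mem_filter] at hc hd
      grind
    obtain ⟨f, hf, hfa, hfb⟩ := hpart 0
    obtain ⟨g, hg, hga, hgb⟩ := hpart 1
    have hz : ∀ z : ZMod 2, z = 0 ∨ z = 1 := by decide
    have := (hf.add_const (-f b)).glue_edge (hg.neg.add_const (g b)) (a := a) (b := b)
      (by simp) (by simp)
      (fun y hy => by have := hfb y hy; omega) (fun y hy => by have := hgb y hy; omega)
      (fun y hy => by have := hfa y hy; omega) (fun y hy => by have := hga y hy; omega)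
      (by simp [ha]) (by simp [hb]) (by simp [ha]) (by simp [hb])
      (fun y hy z hz' hyz => by
        simp only [Finset.mem_filter] at hy hz'
        by_contra! hcon
        have := ht.side_eq hab hyz hcon.1 hcon.2.2.1 hcon.2.1 hcon.2.2.2
        have : (0 : ZMod 2) ≠ 1 := by decide
        grind)
    rwa [← Finset.filter_or, Finset.filter_true_of_mem fun c _ => by
      have := hz (t a c + t b c)
      grind] at this
  · push Not at hedge
    obtain ⟨f, hf⟩ : ∃ f : V → ℤ, ∀ x ∈ S, ∀ y ∈ S, f x = f y → x = y := by
      refine ⟨fun x => if h : x ∈ S then ((S.equivFin ⟨x, h⟩ : ℕ) : ℤ) else 0, ?_⟩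
      intro x hx y hy hxy
      simp only [hx, hy, dif_pos, Nat.cast_inj] at hxy
      simpa using S.equivFin.injective (Fin.ext hxy)
    exact ⟨f, hf, fun p hp q _ r hr s _ _ _ _ h4 => absurd h4 (hedge p hp r hr)⟩

end IsParityTournament

/-! ### Grid models -/

/-- The rectangle of grid positions with rows in `[r₁, r₂)` and columns in `[c₁, c₂)`. -/
def box (r₁ r₂ c₁ c₂ : ℕ) : Set (ℕ × ℕ) :=
  {p | r₁ ≤ p.1 ∧ p.1 < r₂ ∧ c₁ ≤ p.2 ∧ p.2 < c₂}

theorem mem_box {r₁ r₂ c₁ c₂ : ℕ} {p : ℕ × ℕ} :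
    p ∈ box r₁ r₂ c₁ c₂ ↔ r₁ ≤ p.1 ∧ p.1 < r₂ ∧ c₁ ≤ p.2 ∧ p.2 < c₂ := Iff.rfl

/-- The sets `M (r, c)`, for `r < R` and `c < C`, are the branch sets of an `R × C` grid in `H`.
Values at other arguments are irrelevant. -/
structure IsGridModel {W : Type*} (H : SimpleGraph W) (R C : ℕ) (M : ℕ × ℕ → Set W) : Prop where
  connected : ∀ p ∈ box 0 R 0 C, (H.induce (M p)).Connected
  disjoint : ∀ p ∈ box 0 R 0 C, ∀ q ∈ box 0 R 0 C, p ≠ q → Disjoint (M p) (M q)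
  horizontal : ∀ r c, r < R → c + 1 < C → ∃ x ∈ M (r, c), ∃ y ∈ M (r, c + 1), H.Adj x y
  vertical : ∀ r c, r + 1 < R → c < C → ∃ x ∈ M (r, c), ∃ y ∈ M (r + 1, c), H.Adj x y

theorem BalancedMinor.IsMinor.exists_isGridModel {W : Type*} {H : SimpleGraph W} {R C : ℕ}
    (h : BalancedMinor.IsMinor (BalancedMinor.grid R C) H) : ∃ M, IsGridModel H R C M := by
  obtain ⟨X, hX⟩ := h
  let M : ℕ × ℕ → Set W := fun p =>
    if hp : p.1 < R ∧ p.2 < C then X (⟨p.1, hp.1⟩, ⟨p.2, hp.2⟩) else ∅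
  have hM : ∀ p (h₁ : p.1 < R) (h₂ : p.2 < C), M p = X (⟨p.1, h₁⟩, ⟨p.2, h₂⟩) :=
    fun p h₁ h₂ => dif_pos ⟨h₁, h₂⟩
  refine ⟨M, ⟨?_, ?_, ?_, ?_⟩⟩
  · rintro p ⟨-, h₁, -, h₂⟩
    rw [hM p h₁ h₂]
    exact hX.connected _
  · rintro p ⟨-, h₁, -, h₂⟩ q ⟨-, h₃, -, h₄⟩ hpq
    rw [hM p h₁ h₂, hM q h₃ h₄]
    refine hX.disjoint _ _ fun h => hpq ?_
    simp only [Prod.mk.injEq, Fin.mk.injEq] at h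
    exact Prod.ext h.1 h.2
  · intro r c hr hc
    rw [hM (r, c) hr (by simp only; omega), hM (r, c + 1) hr hc]
    exact hX.edge _ _ (by simp [BalancedMinor.grid])
  · intro r c hr hc
    rw [hM (r, c) (by simp only; omega) hc, hM (r + 1, c) hr hc]
    exact hX.edge _ _ (by simp [BalancedMinor.grid])

namespace IsGridModel

variable {W : Type*} {H : SimpleGraph W} {R C : ℕ} {M : ℕ × ℕ → Set W}

/-- The mirror image of a grid model, with left and right exchanged. -/
theorem flip (h : IsGridModel H R C M) : IsGridModel H R C fun p => M (p.1, C - 1 - p.2) where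
  connected p hp := h.connected _ (by simp only [mem_box] at hp ⊢; omega)
  disjoint p hp q hq hpq := by
    simp only [mem_box] at hp hq
    refine h.disjoint _ (by simp only [mem_box]; omega) _ (by simp only [mem_box]; omega) ?_
    intro h
    simp only [Prod.mk.injEq] at h
    exact hpq (Prod.ext h.1 (by omega))
  horizontal r c hr hc := by
    obtain ⟨x, hx, y, hy, hxy⟩ := h.horizontal r (C - 1 - (c + 1)) hr (by omega)
    refine ⟨y, ?_, x, hx, hxy.symm⟩
    have : C - 1 - (c + 1) + 1 = C - 1 - c := by omega
    rwa [this] at hy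
  vertical r c hr hc := h.vertical r _ hr (by omega)

/-- The union of the branch sets at the positions in `S`. -/
abbrev union (M : ℕ × ℕ → Set W) (S : Set (ℕ × ℕ)) : Set W := ⋃ p ∈ S, M p

theorem disjoint_union (h : IsGridModel H R C M) {S T : Set (ℕ × ℕ)} (hS : S ⊆ box 0 R 0 C)
    (hT : T ⊆ box 0 R 0 C) (hST : Disjoint S T) : Disjoint (union M S) (union M T) := by
  simp only [union, Set.disjoint_iUnion_left, Set.disjoint_iUnion_right]
  exact fun q hq p hp => h.disjoint p (hS hp) q (hT hq) fun e => hST.ne_of_mem hp hq e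

theorem connected_box (h : IsGridModel H R C M) {r₁ r₂ c₁ c₂ : ℕ} (hr : r₁ < r₂) (hR : r₂ ≤ R)
    (hc : c₁ < c₂) (hC : c₂ ≤ C) : (H.induce (union M (box r₁ r₂ c₁ c₂))).Connected := by
  have hrow : ∀ r < R, ∀ c₂, c₁ < c₂ → c₂ ≤ C →
      (H.induce (union M (box r (r + 1) c₁ c₂))).Connected := by
    intro r hr c₂ hc hC
    induction c₂, Nat.succ_le_of_lt hc using Nat.le_induction with
    | base =>
      have : box r (r + 1) c₁ (c₁ + 1) = {(r, c₁)} := by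
        ext ⟨x, y⟩; simp only [mem_box, Set.mem_singleton_iff, Prod.mk.injEq]; omega
      rw [Nat.succ_eq_add_one, this, union, Set.biUnion_singleton]
      exact h.connected _ (by simp only [mem_box]; omega)
    | succ c hc' ih =>
      have : box r (r + 1) c₁ (c + 1) = box r (r + 1) c₁ c ∪ {(r, c)} := by
        ext ⟨x, y⟩; simp only [mem_box, Set.mem_union, Set.mem_singleton_iff, Prod.mk.injEq]; omega
      rw [this, union, Set.biUnion_union, Set.biUnion_singleton]
      obtain ⟨x, hx, y, hy, hxy⟩ := h.horizontal r (c - 1) hr (by omega)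
      rw [Nat.sub_add_cancel (by omega)] at hy
      exact H.connected_induce_union (ih (by omega) (by omega)).preconnected
        (h.connected _ (by simp only [mem_box]; omega)).preconnected
        (Set.mem_biUnion (by simp only [mem_box]; omega) hx) hy hxy
  induction r₂, Nat.succ_le_of_lt hr using Nat.le_induction with
  | base => exact hrow r₁ (by omega) c₂ hc hC
  | succ r hr' ih =>
    have : box r₁ (r + 1) c₁ c₂ = box r₁ r c₁ c₂ ∪ box r (r + 1) c₁ c₂ := by
      ext ⟨x, y⟩; simp only [mem_box, Set.mem_union]; omega
    rw [this, union, Set.biUnion_union]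
    obtain ⟨x, hx, y, hy, hxy⟩ := h.vertical (r - 1) c₁ (by omega) (by omega)
    rw [Nat.sub_add_cancel (by omega)] at hy
    exact H.connected_induce_union (ih (by omega) (by omega)).preconnected
      (hrow r (by omega) c₂ hc hC).preconnected
      (Set.mem_biUnion (by simp only [mem_box]; omega) hx)
      (Set.mem_biUnion (by simp only [mem_box]; omega) hy) hxy

theorem connected_union (h : IsGridModel H R C M) {S T : Set (ℕ × ℕ)}
    (hS : (H.induce (union M S)).Connected) (hT : (H.induce (union M T)).Connected)
    {p : ℕ × ℕ} (hp : p ∈ box 0 R 0 C) (hpS : p ∈ S) (hpT : p ∈ T) :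
    (H.induce (union M (S ∪ T))).Connected := by
  obtain ⟨x, hx⟩ := (h.connected p hp).nonempty
  rw [union, Set.biUnion_union]
  exact H.induce_union_connected hS.preconnected hT.preconnected
    ⟨x, Set.mem_biUnion hpS hx, Set.mem_biUnion hpT hx⟩

theorem connected_union_iUnion (h : IsGridModel H R C M) {ι : Type*} {S : Set (ℕ × ℕ)}
    {T : ι → Set (ℕ × ℕ)} (hS : (H.induce (union M S)).Connected)
    (hT : ∀ i, (H.induce (union M (T i))).Connected)
    {p : ℕ × ℕ} (hp : p ∈ box 0 R 0 C) (hpS : p ∈ S) (hpT : ∀ i, p ∈ T i) :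
    (H.induce (union M (S ∪ ⋃ i, T i))).Connected := by
  obtain ⟨x, hx⟩ := (h.connected p hp).nonempty
  have hxS : x ∈ union M S := Set.mem_biUnion hpS hx
  refine H.induce_connected_of_patches x (Set.mem_biUnion (Or.inl hpS) hx) fun {y} hy => ?_
  simp only [union, Set.mem_iUnion, Set.mem_union] at hy
  obtain ⟨q, hq | ⟨i, hq⟩, hy⟩ := hy
  · exact ⟨_, Set.biUnion_subset_biUnion_left fun _ => Or.inl, hxS, Set.mem_biUnion hq hy,
      hS.preconnected _ _⟩
  · exact ⟨_, Set.biUnion_subset_biUnion_left fun _ hz => Or.inr (Set.mem_iUnion_of_mem i hz),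
      Set.mem_biUnion (hpT i) hx, Set.mem_biUnion hq hy, (hT i).preconnected _ _⟩

end IsGridModel

/-- A connected set can be enlarged vertex by vertex inside a larger connected set, so that all
intermediate sizes occur. -/
theorem SimpleGraph.exists_connected_ncard_eq {W : Type*} [Finite W] (H : SimpleGraph W)
    {A B : Set W} (hAB : A ⊆ B) (hA : (H.induce A).Connected) (hB : (H.induce B).Connected)
    {k : ℕ} (hAk : A.ncard ≤ k) (hkB : k ≤ B.ncard) :
    ∃ X, A ⊆ X ∧ X ⊆ B ∧ (H.induce X).Connected ∧ X.ncard = k := by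
  induction k, hAk using Nat.le_induction with
  | base => exact ⟨A, subset_rfl, hAB, hA, rfl⟩
  | succ k hk ih =>
    obtain ⟨X, hAX, hXB, hX, rfl⟩ := ih (by omega)
    obtain ⟨z, hzB, hzX⟩ : ∃ z ∈ B, z ∉ X := by
      by_contra! h
      have := Set.ncard_le_ncard h
      omega
    obtain ⟨⟨x, hx⟩⟩ := hX.nonempty
    obtain ⟨w⟩ := hB.preconnected ⟨x, hXB hx⟩ ⟨z, hzB⟩
    obtain ⟨d, -, hd₁, hd₂⟩ := w.exists_boundary_dart (Subtype.val ⁻¹' X) hx hzX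
    refine ⟨X ∪ {d.snd.1}, hAX.trans Set.subset_union_left,
      Set.union_subset hXB (by simp), ?_, ?_⟩
    · refine H.connected_induce_union hX.preconnected ?_ hd₁ (Set.mem_singleton _) d.adj
      rw [SimpleGraph.induce_singleton_eq_top]
      exact SimpleGraph.preconnected_top
    · have hd : d.snd.1 ∉ X := hd₂
      rw [Set.union_singleton, Set.ncard_insert_of_notMem hd]

/-! ### Layout of a noncrossing order in the grid -/

namespace GridLayout

variable {V : Type*} (G : SimpleGraph V) (idx : V → ℕ) (n b : ℕ)

/-- The part of the branch set of `u` that realizes the edge `uv`: a piece of the row of `u`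
reaching `|idx u - idx v|` columns to the left of column `n - 1`, and, if `v` comes after `u`, a
piece of that column going from the row of `u` to just before the row of `v`. The rows are those of
band `b`, that is, the row of `u` is `b * n + idx u`. -/
def ear (u v : V) : Set (ℕ × ℕ) :=
  box (b * n + idx u) (b * n + idx u + 1) (n - 1 - (idx v - idx u) - (idx u - idx v)) n ∪
    box (b * n + idx u) (b * n + idx v) (n - 1 - (idx v - idx u)) (n - 1 - (idx v - idx u) + 1)

/-- The smallest branch set of `u`, within the first `n` columns of band `b`. -/
def core (u : V) : Set (ℕ × ℕ) :=
  box (b * n + idx u) (b * n + idx u + 1) (n - 1) n ∪ ⋃ v : G.neighborSet u, ear idx n b u v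

/-- The column in which the link from the core of the `i`-th vertex to band `i` changes rows. Links
to bands further away from band `b` turn earlier, so that the links are nested and do not meet. -/
def turn (i : ℕ) : ℕ := if i ≤ b then n + i else 2 * n - 1 - i

/-- A path of grid positions, in the left half of the grid up to its last step, from the core of the
`i`-th vertex in band `b` to the first column of the right half of band `i`. -/
def link (i : ℕ) : Set (ℕ × ℕ) :=
  box (b * n + i) (b * n + i + 1) (n - 1) (turn n b i + 1) ∪
    box (min (b * n + i) (i * n)) (max (b * n + i) (i * n) + 1) (turn n b i) (turn n b i + 1) ∪
    box (i * n) (i * n + 1) (turn n b i) (2 * n + 1)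

/-- The left half of band `j`. -/
abbrev leftHalf (j : ℕ) : Set (ℕ × ℕ) := box (j * n) (j * n + n) 0 (2 * n)

/-- The right half of band `j`. -/
abbrev rightHalf (j : ℕ) : Set (ℕ × ℕ) := box (j * n) (j * n + n) (2 * n) (4 * n)

/-- The largest branch set of `u`. -/
def full (u : V) : Set (ℕ × ℕ) :=
  core G idx n b u ∪ link n b (idx u) ∪ rightHalf n (idx u)

variable {G idx n b}

theorem mul_add_le_mul {i j : ℕ} (n : ℕ) (h : i < j) : i * n + n ≤ j * n := by
  rw [← Nat.succ_mul]
  exact Nat.mul_le_mul_right n h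

/-- The cores occupy column `n - 1` in their own rows only. -/
theorem core_bounds (hidx : ∀ v, idx v < n) {u : V} {p : ℕ × ℕ} (hp : p ∈ core G idx n b u) :
    b * n ≤ p.1 ∧ p.1 < b * n + n ∧ p.2 < n ∧ (p.2 = n - 1 → p.1 = b * n + idx u) := by
  have hu := hidx u
  simp only [core, ear, Set.mem_union, Set.mem_iUnion, mem_box] at hp
  obtain hp | ⟨v, hp⟩ := hp
  · omega
  · have := hidx v
    omega

/-- A column piece at distance `d` from column `n - 1` belongs to an edge `uw` spanning `d` rows. An
ear of a vertex `v` strictly between `u` and `w` reaches that far only if it belongs to an edge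
leaving the interval from `u` to `w`, which would cross `uw`. -/
theorem disjoint_core (hidx : ∀ v, idx v < n)
    (hnc : ∀ p q r s, idx p < idx q → idx q < idx r → idx r < idx s → G.Adj p r → G.Adj q s → False)
    {u v : V} (huv : idx u < idx v) : Disjoint (core G idx n b u) (core G idx n b v) := by
  rw [Set.disjoint_left]
  intro p hp hq
  have hv := hidx v
  simp only [core, ear, Set.mem_union, Set.mem_iUnion, mem_box] at hp hq
  obtain hp | ⟨⟨w, hw⟩, hp⟩ := hp
  · obtain hq | ⟨⟨x, hx⟩, hq⟩ := hq <;> omega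
  · have := hidx w
    obtain hq | ⟨⟨x, hx⟩, hq⟩ := hq
    · omega
    · have := hidx x
      rw [SimpleGraph.mem_neighborSet] at hw hx
      have k1 := hnc u v w x huv
      have k2 := hnc x u v w
      have hx' := hx.symm
      grind

theorem turn_bounds {i : ℕ} (hi : i < n) : n ≤ turn n b i ∧ turn n b i < 2 * n := by
  unfold turn; grind

theorem disjoint_core_link (hidx : ∀ v, idx v < n) {u : V} {i : ℕ} (hi : i < n) (hui : idx u ≠ i) :
    Disjoint (core G idx n b u) (link n b i) := by
  rw [Set.disjoint_left]
  intro p hp hq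
  have := core_bounds hidx hp
  have := turn_bounds (b := b) hi
  simp only [link, Set.mem_union, mem_box] at hq
  omega

theorem disjoint_link {i j : ℕ} (hj : j < n) (hij : i < j) :
    Disjoint (link n b i) (link n b j) := by
  rw [Set.disjoint_left]
  intro p hp hq
  have h1 := mul_add_le_mul n hij
  have h2 : i < b → i * n + n ≤ b * n := mul_add_le_mul n
  have h3 : b < i → b * n + n ≤ i * n := mul_add_le_mul n
  have h4 : j < b → j * n + n ≤ b * n := mul_add_le_mul n
  have h5 : b < j → b * n + n ≤ j * n := mul_add_le_mul n
  have h6 : i = b → i * n = b * n := by rintro rfl; rfl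
  have h7 : j = b → j * n = b * n := by rintro rfl; rfl
  simp only [link, turn, Set.mem_union, mem_box] at hp hq
  generalize i * n = I at *
  generalize j * n = J at *
  generalize b * n = B at *
  obtain (hp | hp) | hp := hp <;> obtain (hq | hq) | hq := hq <;> split_ifs at hp hq <;> omega

theorem disjoint_full (hidx : ∀ v, idx v < n)
    (hnc : ∀ p q r s, idx p < idx q → idx q < idx r → idx r < idx s → G.Adj p r → G.Adj q s → False)
    {u v : V} (huv : idx u < idx v) : Disjoint (full G idx n b u) (full G idx n b v) := by
  have hrow := mul_add_le_mul n huv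
  have hlr : ∀ i j, i < n → i * n + n ≤ j * n ∨ j * n + n ≤ i * n →
      Disjoint (link n b i) (rightHalf n j) := by
    intro i j hi hij
    rw [Set.disjoint_left]
    intro p hp hq
    have := turn_bounds (b := b) hi
    simp only [link, Set.mem_union, mem_box] at hp hq
    omega
  have hcr : ∀ u j, Disjoint (core G idx n b u) (rightHalf n j) := by
    intro u j
    rw [Set.disjoint_left]
    intro p hp hq
    have := core_bounds hidx hp
    simp only [mem_box] at hq
    omega
  have hrr : Disjoint (rightHalf n (idx u)) (rightHalf n (idx v)) := by
    rw [Set.disjoint_left]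
    intro p hp hq
    simp only [mem_box] at hp hq
    omega
  simp only [full, Set.disjoint_union_left, Set.disjoint_union_right]
  exact ⟨⟨⟨⟨disjoint_core hidx hnc huv, (disjoint_core_link hidx (hidx u) huv.ne').symm⟩,
    (hcr v _).symm⟩, ⟨disjoint_core_link hidx (hidx v) huv.ne, disjoint_link (hidx v) huv⟩,
    (hlr _ _ (hidx v) (Or.inr hrow)).symm⟩, ⟨hcr u _, hlr _ _ (hidx u) (Or.inl hrow)⟩, hrr⟩

theorem core_subset_leftHalf (hidx : ∀ v, idx v < n) (u : V) :
    core G idx n b u ⊆ leftHalf n b := by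
  intro p hp
  have := core_bounds hidx hp
  simp only [mem_box]
  omega

theorem full_subset (hidx : ∀ v, idx v < n) (hb : b < n) (u : V) :
    full G idx n b u ⊆ box 0 (n ^ 2) 0 (4 * n) := by
  have hu := hidx u
  have h1 := mul_add_le_mul n hb
  have h2 := mul_add_le_mul n hu
  rw [← sq] at h1 h2
  have := turn_bounds (b := b) hu
  rintro p ((hp | hp) | hp)
  · have := core_bounds hidx hp
    simp only [mem_box]
    omega
  · simp only [link, Set.mem_union, mem_box] at hp ⊢
    omega
  · simp only [mem_box] at hp ⊢
    omega

variable {W : Type*} {H : SimpleGraph W} {M : ℕ × ℕ → Set W}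

theorem connected_core (hM : IsGridModel H (n ^ 2) (4 * n) M) (hidx : ∀ v, idx v < n) (hb : b < n)
    (u : V) : (H.induce (IsGridModel.union M (core G idx n b u))).Connected := by
  have hu := hidx u
  have h1 := mul_add_le_mul n hb
  rw [← sq] at h1
  refine hM.connected_union_iUnion (p := (b * n + idx u, n - 1)) ?_ ?_ ?_ ?_ ?_
  · exact hM.connected_box (by omega) (by omega) (by omega) (by omega)
  · intro v
    have hv := hidx v
    have hrow := hM.connected_box (r₁ := b * n + idx u) (r₂ := b * n + idx u + 1)
      (c₁ := n - 1 - (idx v - idx u) - (idx u - idx v)) (c₂ := n) (by omega) (by omega) (by omega)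
      (by omega)
    by_cases huv : idx u < idx v
    · exact hM.connected_union hrow
        (hM.connected_box (by omega) (by omega) (by omega) (by omega))
        (p := (b * n + idx u, n - 1 - (idx v - idx u))) (by simp only [mem_box]; omega)
        (by simp only [mem_box]; omega) (by simp only [mem_box]; omega)
    · have : box (b * n + idx u) (b * n + idx v) (n - 1 - (idx v - idx u))
          (n - 1 - (idx v - idx u) + 1) = ∅ := by
        ext p
        simp only [mem_box, Set.mem_empty_iff_false, iff_false]
        omega
      rwa [ear, this, Set.union_empty]
  · simp only [mem_box]; omega
  · simp only [mem_box]; omega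
  · intro v
    exact Or.inl (by simp only [mem_box]; omega)

theorem connected_full (hM : IsGridModel H (n ^ 2) (4 * n) M) (hidx : ∀ v, idx v < n) (hb : b < n)
    (u : V) : (H.induce (IsGridModel.union M (full G idx n b u))).Connected := by
  have hu := hidx u
  have h1 := mul_add_le_mul n hb
  have h2 := mul_add_le_mul n hu
  rw [← sq] at h1 h2
  have ht := turn_bounds (b := b) hu
  have hlink : (H.induce (IsGridModel.union M (link n b (idx u)))).Connected := by
    refine hM.connected_union (p := (idx u * n, turn n b (idx u))) (hM.connected_union
      (p := (b * n + idx u, turn n b (idx u)))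
      (hM.connected_box (by omega) (by omega) (by omega) (by omega))
      (hM.connected_box (by omega) (by omega) (by omega) (by omega)) ?_ ?_ ?_)
      (hM.connected_box (by omega) (by omega) (by omega) (by omega)) ?_ (Or.inr ?_) ?_ <;>
    simp only [mem_box] <;> omega
  refine hM.connected_union (p := (idx u * n, 2 * n)) (hM.connected_union
    (p := (b * n + idx u, n - 1)) (connected_core hM hidx hb u) hlink ?_ (Or.inl ?_)
    (Or.inl (Or.inl ?_)))
    (hM.connected_box (by omega) (by omega) (by omega) (by omega)) ?_ (Or.inr (Or.inr ?_)) ?_ <;>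
  simp only [mem_box] <;> omega

theorem exists_adj_core (hM : IsGridModel H (n ^ 2) (4 * n) M) (hidx : ∀ v, idx v < n) (hb : b < n)
    {u v : V} (huv : G.Adj u v) (hlt : idx u < idx v) :
    ∃ x ∈ IsGridModel.union M (core G idx n b u), ∃ y ∈ IsGridModel.union M (core G idx n b v),
      H.Adj x y := by
  have hv := hidx v
  have h1 := mul_add_le_mul n hb
  rw [← sq] at h1
  obtain ⟨x, hx, y, hy, hxy⟩ := hM.vertical (b * n + idx v - 1) (n - 1 - (idx v - idx u))
    (by omega) (by omega)
  rw [Nat.sub_add_cancel (by omega)] at hy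
  refine ⟨x, Set.mem_biUnion (Or.inr (Set.mem_iUnion_of_mem ⟨v, huv⟩ (Or.inr ?_))) hx, y,
    Set.mem_biUnion (Or.inr (Set.mem_iUnion_of_mem ⟨u, huv.symm⟩ (Or.inl ?_))) hy, hxy⟩ <;>
  simp only [mem_box] <;> omega

/-- If the left half of band `b` is at most as large as the right half of every band, then a common
size of the branch sets can be found between the sizes of the cores and of the full sets. -/
theorem exists_balanced [Finite W] (hM : IsGridModel H (n ^ 2) (4 * n) M) (hidx : ∀ v, idx v < n)
    (hinj : Function.Injective idx)
    (hnc : ∀ p q r s, idx p < idx q → idx q < idx r → idx r < idx s → G.Adj p r → G.Adj q s → False)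
    (hb : b < n)
    (hmin : ∀ j < n, (IsGridModel.union M (leftHalf n b)).ncard ≤
      (IsGridModel.union M (rightHalf n j)).ncard) :
    BalancedMinor.IsBalancedMinor G H := by
  have hX : ∀ u, ∃ X, IsGridModel.union M (core G idx n b u) ⊆ X ∧
      X ⊆ IsGridModel.union M (full G idx n b u) ∧ (H.induce X).Connected ∧
      X.ncard = (IsGridModel.union M (leftHalf n b)).ncard := fun u =>
    H.exists_connected_ncard_eq
      (Set.biUnion_subset_biUnion_left fun _ hp => Or.inl (Or.inl hp))
      (connected_core hM hidx hb u) (connected_full hM hidx hb u)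
      (Set.ncard_le_ncard (Set.biUnion_subset_biUnion_left (core_subset_leftHalf hidx u)))
      ((hmin _ (hidx u)).trans
        (Set.ncard_le_ncard (Set.biUnion_subset_biUnion_left fun _ hp => Or.inr hp)))
  choose X hcore hfull hconn hcard using hX
  refine ⟨X, ⟨fun u => ?_, fun u v huv => ?_, hconn, fun u v huv => ?_⟩, _, hcard⟩
  · obtain ⟨x⟩ := (hconn u).nonempty
    exact ⟨x.1, x.2⟩
  · refine Disjoint.mono (hfull u) (hfull v) (hM.disjoint_union (full_subset hidx hb u)
      (full_subset hidx hb v) ?_)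
    rcases (hinj.ne huv).lt_or_gt with h | h
    · exact disjoint_full hidx hnc h
    · exact (disjoint_full hidx hnc h).symm
  · rcases (hinj.ne huv.ne).lt_or_gt with h | h
    · obtain ⟨x, hx, y, hy, hxy⟩ := exists_adj_core hM hidx hb huv h
      exact ⟨x, hcore u hx, y, hcore v hy, hxy⟩
    · obtain ⟨x, hx, y, hy, hxy⟩ := exists_adj_core hM hidx hb huv.symm h
      exact ⟨y, hcore u hy, x, hcore v hx, hxy.symm⟩

end GridLayout

/-! ### From outerplanar graphs to balanced minors -/

theorem mainTheorem3 {V W : Type*} [Finite V] [Finite W] (n : ℕ) (H : SimpleGraph W)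
    (hH : BalancedMinor.IsMinor (BalancedMinor.grid (n ^ 2) (4 * n)) H)
    (G : SimpleGraph V) (hV : Nat.card V = n) (hG : BalancedMinor.IsOuterplanar G) :
    BalancedMinor.IsBalancedMinor G H := by
  have := Fintype.ofFinite V
  obtain ⟨t, ht⟩ := hG.exists_parityTournament
  obtain ⟨f, hf⟩ := ht.exists_isNoncrossingOn Finset.univ
  obtain ⟨idx, hinj, hidx, hnc⟩ := hf.exists_rank
  rw [← Nat.card_eq_fintype_card, hV] at hidx
  obtain ⟨M, hM⟩ := hH.exists_isGridModel
  rcases Nat.eq_zero_or_pos n with rfl | hn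
  · have : IsEmpty V := ⟨fun v => absurd (hidx v) (Nat.not_lt_zero _)⟩
    exact ⟨fun v => isEmptyElim v, ⟨isEmptyElim, isEmptyElim, isEmptyElim, isEmptyElim⟩, 0,
      isEmptyElim⟩
  obtain ⟨b, hb, hbmin⟩ := (Finset.range n).exists_min_image
    (fun j => min (IsGridModel.union M (GridLayout.leftHalf n j)).ncard
      (IsGridModel.union M (GridLayout.rightHalf n j)).ncard) ⟨0, Finset.mem_range.2 hn⟩
  rw [Finset.mem_range] at hb
  simp only [Finset.mem_range] at hbmin
  rcases le_total (IsGridModel.union M (GridLayout.leftHalf n b)).ncard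
      (IsGridModel.union M (GridLayout.rightHalf n b)).ncard with hle | hle
  · refine GridLayout.exists_balanced hM hidx hinj hnc hb fun j hj => ?_
    have h : min _ _ ≤ min _ _ := hbmin j hj
    rw [min_eq_left hle] at h
    exact h.trans (min_le_right _ _)
  · -- The lightest half is a right half; reflect the grid.
    have hflip : ∀ r₁ r₂ c₁ c₂ c₃ c₄, c₂ ≤ 4 * n → c₃ = 4 * n - c₂ → c₄ = 4 * n - c₁ →
        IsGridModel.union (fun p => M (p.1, 4 * n - 1 - p.2)) (box r₁ r₂ c₁ c₂) =
          IsGridModel.union M (box r₁ r₂ c₃ c₄) := by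
      intro r₁ r₂ c₁ c₂ c₃ c₄ h2 h3 h4
      ext x
      simp only [IsGridModel.union, Set.mem_iUnion, mem_box]
      constructor
      · rintro ⟨⟨r, c⟩, hp, hx⟩
        exact ⟨(r, 4 * n - 1 - c), by simp only at hp ⊢; omega, hx⟩
      · rintro ⟨⟨r, c⟩, hp, hx⟩
        refine ⟨(r, 4 * n - 1 - c), by simp only at hp ⊢; omega, ?_⟩
        have : 4 * n - 1 - (4 * n - 1 - c) = c := by simp only at hp; omega
        simpa only [this] using hx
    refine GridLayout.exists_balanced hM.flip hidx hinj hnc hb fun j hj => ?_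
    rw [hflip _ _ _ _ (2 * n) (4 * n) (by omega) (by omega) (by omega),
      hflip _ _ _ _ 0 (2 * n) (by omega) (by omega) (by omega)]
    have h : min _ _ ≤ min _ _ := hbmin j hj
    rw [min_eq_right hle] at h
    exact h.trans (min_le_left _ _)
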